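/- Let $G$ be a topological group, and write $V\subseteq_1 G$ if $V$ is an open neighbourhood of the identity of $G$. For $V,U\subseteq_1 G$ and ordinals $\beta$, define the relation $\mathrm{rk}(V,U)\le\beta$ by recursion on $\beta$: it holds if and only if either $U\subseteq V$, or there is $W\subseteq_1 G$ such that for every $g\in U$ one has $\mathrm{rk}(V,gWg^{-1})\le\gamma$ for some $\gamma<\beta$. Let $\mathrm{rk}(V,U)$ be the least ordinal $\beta$ with $\mathrm{rk}(V,U)\le\beta$, and $\mathrm{rk}(V,U)=\infty$ if there is none, where $\infty$ is greater than every ordinal and $\infty+1=\infty$. The balanced rank of $G$ is $$\mathrm{rk}(G):=\sup\{\mathrm{rk}(V,G)+1 : V\subseteq_1 G\}.$$ A Polish group is a topological group whose topology is separable and induced by some complete metric; it is CLI if it admits a metric compatible with its topology that is both complete and left-invariant. Theorem. For every Polish group $G$, $$G\text{ is CLI}\iff \mathrm{rk}(G)<\infty\iff \mathrm{rk}(G)<\omega_1 .$$ Moreover, for every ordinal $\alpha$ with $0<\alpha<\omega_1$ there exists a Polish group $G$ with $\mathrm{rk}(G)=\alpha$. -/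

import Mathlib

open scoped Ordinal

universe u

namespace BalancedGroup

/-- A topological group is CLI if it admits a metric that is compatible with its topology,
left-invariant and complete. -/
def IsCLI (G : Type u) [Group G] [t : TopologicalSpace G] : Prop :=
  ∃ m : MetricSpace G,
    m.toPseudoMetricSpace.toUniformSpace.toTopologicalSpace = t ∧
    (∀ g h h' : G, m.dist (g * h) (g * h') = m.dist h h') ∧
    @CompleteSpace G m.toPseudoMetricSpace.toUniformSpace

/-- `RankLE V β U` is the relation `rk(V, U) ≤ β`, by recursion on the ordinal `β`: either
`U ⊆ V` (rank zero), or there is an open neighbourhood `W` of the identity such that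
`rk(V, g W g⁻¹) < β` for every `g ∈ U`. -/
def RankLE {G : Type u} [Group G] [TopologicalSpace G] (V : Set G) (β : Ordinal.{u})
    (U : Set G) : Prop :=
  U ⊆ V ∨ ∃ W : Set G, IsOpen W ∧ (1 : G) ∈ W ∧
    ∀ g ∈ U, ∃ γ : Ordinal.{u}, ∃ _ : γ < β, RankLE V γ ((fun w => g * w * g⁻¹) '' W)
termination_by β

/-- The rank `rk(V, U)`: the least ordinal `β` with `rk(V, U) ≤ β`, and `⊤` if there is none. -/
noncomputable def pairRank {G : Type u} [Group G] [TopologicalSpace G] (V U : Set G) :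
    WithTop Ordinal.{u} :=
  ⨅ (β : Ordinal.{u}) (_ : RankLE V β U), (β : WithTop Ordinal.{u})

/-- The balanced rank `rk(G)`: the supremum of `rk(V, G) + 1` over all open neighbourhoods `V`
of the identity. -/
noncomputable def balancedRank (G : Type u) [Group G] [TopologicalSpace G] :
    WithTop Ordinal.{u} :=
  ⨆ (V : Set G) (_ : IsOpen V ∧ (1 : G) ∈ V), (pairRank V Set.univ + 1)

end BalancedGroup

/-! If every `rk(V, G)` exists, induction on the rank turns left Cauchy sequences into right Cauchy
ones (`RankLE.eventually_mul_inv_mem`). Polish groups are complete for the two-sided uniformity, so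
every left Cauchy sequence converges, which is CLI (`isCLI_iff`). Conversely, if some `rk(V, G)` is
not a countable ordinal, separability lets this persist along conjugates `x n * C n * (x n)⁻¹` with
`C n` shrinking and `x` left Cauchy. A limit of `x` would force these conjugates into `V`, so `G` is
not CLI (`exists_rankLE_of_isCLI`). A countable base at the identity then bounds `rk(G)` below `ω₁`.
For the examples, `towerGroup` acts on finitely supported functions from a well-order of type `α` to
`ℤ`, like an iterated wreath product of copies of `ℤ`. Stabilizers of finite sets form a base at the
identity, and conjugation moves the set. The rank records the coordinate above which nothing can
still be moved: `rankLE_fixing` bounds it above, `position_le_of_rankLE` below. -/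

namespace BalancedGroup

open Filter Topology Set
open Ordinal hiding univ

/-! ### Basic properties of the rank. -/

section Rank

variable {G : Type u} [Group G]

/-- The conjugate `g W g⁻¹` of a set `W`. -/
def conjSet (g : G) (W : Set G) : Set G := (fun w => g * w * g⁻¹) '' W

theorem mem_conjSet {g x : G} {W : Set G} : x ∈ conjSet g W ↔ g⁻¹ * x * g ∈ W := by
  constructor
  · rintro ⟨w, hw, rfl⟩
    simpa [mul_assoc] using hw
  · intro h
    exact ⟨_, h, by simp [mul_assoc]⟩

theorem conjSet_mono (g : G) {W W' : Set G} (h : W ⊆ W') : conjSet g W ⊆ conjSet g W' :=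
  image_mono h

theorem one_mem_conjSet (g : G) {W : Set G} (h : (1 : G) ∈ W) : (1 : G) ∈ conjSet g W := by
  simpa [mem_conjSet] using h

theorem conjSet_conjSet (g h : G) (W : Set G) : conjSet g (conjSet h W) = conjSet (g * h) W := by
  ext x
  simp [mem_conjSet, mul_assoc]

variable [TopologicalSpace G]

theorem isOpen_conjSet [IsTopologicalGroup G] (g : G) {W : Set G} (h : IsOpen W) :
    IsOpen (conjSet g W) := by
  have : conjSet g W = (fun x => g⁻¹ * x * g) ⁻¹' W := by
    ext x
    exact mem_conjSet
  rw [this]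
  exact h.preimage (by fun_prop)

theorem rankLE_iff {V U : Set G} {β : Ordinal.{u}} :
    RankLE V β U ↔ U ⊆ V ∨ ∃ W : Set G, IsOpen W ∧ (1 : G) ∈ W ∧
      ∀ g ∈ U, ∃ γ < β, RankLE V γ (conjSet g W) := by
  rw [RankLE]
  simp only [exists_prop, conjSet]

theorem RankLE.mono {V V' U U' : Set G} {β β' : Ordinal.{u}} (h : RankLE V β U)
    (hV : V ⊆ V') (hU : U' ⊆ U) (hβ : β ≤ β') : RankLE V' β' U' := by
  induction β using WellFoundedLT.induction generalizing U U' β' with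
  | ind β ih =>
    rw [rankLE_iff] at h ⊢
    rcases h with h | ⟨W, hW, h1, h⟩
    · exact Or.inl (hU.trans (h.trans hV))
    · refine Or.inr ⟨W, hW, h1, fun g hg => ?_⟩
      obtain ⟨γ, hγ, hr⟩ := h g (hU hg)
      exact ⟨γ, hγ.trans_le hβ, ih γ hγ hr subset_rfl le_rfl⟩

theorem pairRank_le_iff {V U : Set G} {β : Ordinal.{u}} :
    pairRank V U ≤ β ↔ RankLE V β U := by
  constructor
  · intro h
    by_contra hn
    have : ((Order.succ β : Ordinal.{u}) : WithTop Ordinal.{u}) ≤ pairRank V U := by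
      refine le_iInf₂ fun γ hγ => ?_
      rw [WithTop.coe_le_coe, Order.succ_le_iff]
      by_contra hlt
      exact hn (hγ.mono subset_rfl subset_rfl (not_lt.1 hlt))
    have := WithTop.coe_le_coe.1 (this.trans h)
    exact absurd (Order.lt_succ β) (not_lt.2 this)
  · intro h
    exact iInf₂_le (f := fun (β : Ordinal.{u}) (_ : RankLE V β U) =>
      (β : WithTop Ordinal.{u})) β h

theorem exists_rankLE_of_balancedRank_lt_top (h : balancedRank G < ⊤) {V : Set G}
    (hV : IsOpen V) (h1 : (1 : G) ∈ V) : ∃ β : Ordinal.{u}, RankLE V β univ := by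
  have hle : pairRank V univ + 1 ≤ balancedRank G :=
    le_iSup₂ (f := fun (V : Set G) (_ : IsOpen V ∧ (1 : G) ∈ V) => pairRank V univ + 1) V ⟨hV, h1⟩
  have hlt := hle.trans_lt h
  have hne : pairRank V univ ≠ ⊤ := by
    intro ht
    simp [ht] at hlt
  obtain ⟨β, hβ⟩ := WithTop.ne_top_iff_exists.1 hne
  exact ⟨β, pairRank_le_iff.1 hβ.ge⟩

theorem balancedRank_le {α : Ordinal.{u}}
    (h : ∀ V : Set G, IsOpen V → (1 : G) ∈ V → ∃ β < α, RankLE V β univ) :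
    balancedRank G ≤ α := by
  refine iSup₂_le fun V hV => ?_
  obtain ⟨β, hβ, hr⟩ := h V hV.1 hV.2
  calc pairRank V univ + 1 ≤ (β : WithTop Ordinal.{u}) + 1 := by
        gcongr
        exact pairRank_le_iff.2 hr
    _ = ((Order.succ β : Ordinal.{u}) : WithTop Ordinal.{u}) := by
        rw [Order.succ_eq_add_one]; rfl
    _ ≤ α := WithTop.coe_le_coe.2 (Order.succ_le_of_lt hβ)

theorem lt_balancedRank {V : Set G} (hV : IsOpen V) (h1 : (1 : G) ∈ V) {β : Ordinal.{u}}
    (h : ∀ γ, RankLE V γ univ → β ≤ γ) : (β : WithTop Ordinal.{u}) < balancedRank G := by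
  have hle : pairRank V univ + 1 ≤ balancedRank G :=
    le_iSup₂ (f := fun (V : Set G) (_ : IsOpen V ∧ (1 : G) ∈ V) => pairRank V univ + 1) V ⟨hV, h1⟩
  refine lt_of_lt_of_le ?_ hle
  have h2 : (β : WithTop Ordinal.{u}) ≤ pairRank V univ :=
    le_iInf₂ fun γ hγ => WithTop.coe_le_coe.2 (h γ hγ)
  calc (β : WithTop Ordinal.{u}) < ((Order.succ β : Ordinal.{u}) : WithTop Ordinal.{u}) :=
        WithTop.coe_lt_coe.2 (Order.lt_succ β)
    _ = (β : WithTop Ordinal.{u}) + 1 := by rw [Order.succ_eq_add_one]; rfl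
    _ ≤ pairRank V univ + 1 := by gcongr

end Rank

/-! ### Left Cauchy sequences, and finite or ordinal rank implies CLI. -/

section LeftCauchy

variable {G : Type u} [Group G] [TopologicalSpace G]

/-- A sequence that is Cauchy for the left uniformity of the group. -/
def LeftCauchySeq (x : ℕ → G) : Prop :=
  ∀ V ∈ 𝓝 (1 : G), ∃ N, ∀ m ≥ N, ∀ n ≥ N, (x m)⁻¹ * x n ∈ V

/-- A sequence that is Cauchy for the right uniformity of the group. -/
def RightCauchySeq (x : ℕ → G) : Prop :=
  ∀ V ∈ 𝓝 (1 : G), ∃ N, ∀ m ≥ N, ∀ n ≥ N, x m * (x n)⁻¹ ∈ V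

/-- Birkhoff–Kakutani: metrize the countably generated left uniformity by `r`, truncate at 1 and
take the supremum over left translates. The topology survives because smallness of `r x y` is
controlled by `x⁻¹ * y`, which left translation does not change. -/
theorem exists_leftInvariant_metric [IsTopologicalGroup G] [FirstCountableTopology G]
    [T0Space G] : ∃ m : MetricSpace G,
      m.toPseudoMetricSpace.toUniformSpace.toTopologicalSpace = ‹TopologicalSpace G› ∧
      ∀ g h h' : G, m.dist (g * h) (g * h') = m.dist h h' := by
  have key : ∃ r : G → G → ℝ, (∀ x, r x x = 0) ∧ (∀ x y, r x y = r y x) ∧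
      (∀ x y z, r x z ≤ r x y + r y z) ∧ (∀ x y, r x y = 0 → x = y) ∧
      (∀ ε > 0, ∃ V ∈ 𝓝 (1 : G), ∀ x y, x⁻¹ * y ∈ V → r x y < ε) ∧
      (∀ V ∈ 𝓝 (1 : G), ∃ ε > 0, ∀ x y, r x y < ε → x⁻¹ * y ∈ V) := by
    let := IsTopologicalGroup.leftUniformSpace G
    have : (uniformity G).IsCountablyGenerated :=
      inferInstanceAs (Filter.comap (fun p : G × G => p.1⁻¹ * p.2) (𝓝 1)).IsCountablyGenerated
    let ρ : MetricSpace G := UniformSpace.metricSpace G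
    have hU : uniformity G = Filter.comap (fun p : G × G => p.1⁻¹ * p.2) (𝓝 1) := rfl
    refine ⟨dist, dist_self, dist_comm, dist_triangle, fun x y => eq_of_dist_eq_zero, ?_, ?_⟩
    · intro ε hε
      have := Metric.dist_mem_uniformity (α := G) hε
      rw [hU] at this
      obtain ⟨V, hV, h⟩ := this
      exact ⟨V, hV, fun x y hxy => @h (x, y) hxy⟩
    · intro V hV
      have : (fun p : G × G => p.1⁻¹ * p.2) ⁻¹' V ∈ uniformity G := by
        rw [hU]
        exact Filter.preimage_mem_comap hV
      obtain ⟨ε, hε, h⟩ := Metric.mem_uniformity_dist.1 this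
      exact ⟨ε, hε, fun x y hxy => @h x y hxy⟩
  obtain ⟨r, r_self, r_comm, r_tri, r_eq, r_lt, r_mem⟩ := key
  have r_nonneg : ∀ x y, 0 ≤ r x y := fun x y => by
    have := r_tri x y x
    rw [r_self, r_comm y x] at this
    linarith
  have hbdd : ∀ x y, BddAbove (range fun g => min (r (g * x) (g * y)) 1) := fun x y =>
    ⟨1, by rintro _ ⟨g, rfl⟩; exact min_le_right _ _⟩
  have hle : ∀ x y g, min (r (g * x) (g * y)) 1 ≤ ⨆ g, min (r (g * x) (g * y)) 1 :=
    fun x y g => le_ciSup (hbdd x y) g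
  let m : MetricSpace G :=
    { dist := fun x y => ⨆ g, min (r (g * x) (g * y)) 1
      dist_self := fun x => by simp [r_self]
      dist_comm := fun x y => by simp only [r_comm]
      dist_triangle := fun x y z => by
        refine ciSup_le fun g => ?_
        have h1 := hle x y g
        have h2 := hle y z g
        have h3 := r_tri (g * x) (g * y) (g * z)
        have h4 := r_nonneg (g * x) (g * y)
        have h5 := r_nonneg (g * y) (g * z)
        refine le_trans ?_ (add_le_add h1 h2)
        rcases le_total (r (g * x) (g * y)) 1 with h | h <;>
        rcases le_total (r (g * y) (g * z)) 1 with h' | h' <;>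
        simp only [min_eq_left h, min_eq_right h, min_eq_left h', min_eq_right h'] <;>
        first
        | exact (min_le_left _ _).trans h3
        | exact (min_le_right _ _).trans (by linarith)
      eq_of_dist_eq_zero := fun {x y} h => by
        apply r_eq
        have h1 := hle x y 1
        have h0 : (⨆ g, min (r (g * x) (g * y)) 1) = 0 := h
        rw [h0, one_mul, one_mul] at h1
        rcases min_le_iff.1 h1 with h2 | h2
        · exact le_antisymm h2 (r_nonneg _ _)
        · norm_num at h2 }
  have hm : ∀ x y, m.dist x y = ⨆ g, min (r (g * x) (g * y)) 1 := fun _ _ => rfl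
  refine ⟨m, ?_, ?_⟩
  · refine TopologicalSpace.ext_nhds fun x => ?_
    ext s
    rw [@Metric.mem_nhds_iff G m.toPseudoMetricSpace]
    have hmem : s ∈ 𝓝 x ↔ (fun g => x * g) ⁻¹' s ∈ 𝓝 (1 : G) := by
      rw [← mem_map, map_mul_left_nhds, mul_one]
    rw [hmem]
    constructor
    · rintro ⟨ε, hε, h⟩
      obtain ⟨V, hV, hr⟩ := r_lt (ε / 2) (half_pos hε)
      refine mem_of_superset hV fun v hv => h ?_
      show m.dist (x * v) x < ε
      rw [hm]
      refine lt_of_le_of_lt (ciSup_le fun g => ?_) (half_lt_self hε)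
      refine (min_le_left _ _).trans ?_
      rw [r_comm]
      exact (hr _ _ (by simpa [mul_assoc] using hv)).le
    · intro h
      obtain ⟨ε, hε, hr⟩ := r_mem _ h
      refine ⟨min ε 1, lt_min hε one_pos, fun y hy => ?_⟩
      have hy' : (⨆ g, min (r (g * y) (g * x)) 1) < min ε 1 := hy
      have h1 := (hle y x 1).trans_lt hy'
      rw [one_mul, one_mul] at h1
      have h2 : r x y < ε := by
        rw [r_comm]
        rcases min_lt_iff.1 h1 with h2 | h2
        · exact h2.trans_le (min_le_left _ _)
        · exact absurd (h2.trans_le (min_le_right _ _)) (lt_irrefl _)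
      simpa using hr x y h2
  · intro g h h'
    rw [hm, hm]
    refine (Equiv.mulRight g).iSup_congr fun k => ?_
    simp [mul_assoc]

theorem leftCauchySeq_iff_cauchySeq (m : MetricSpace G)
    (ht : m.toPseudoMetricSpace.toUniformSpace.toTopologicalSpace = ‹TopologicalSpace G›)
    (hinv : ∀ g h h' : G, m.dist (g * h) (g * h') = m.dist h h') (x : ℕ → G) :
    LeftCauchySeq x ↔ @CauchySeq G ℕ m.toPseudoMetricSpace.toUniformSpace _ x := by
  subst ht
  have hd : ∀ a b : G, dist a b = dist (a⁻¹ * b) 1 := fun a b => by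
    have := hinv a⁻¹ a b
    rw [inv_mul_cancel] at this
    rw [dist_comm _ (1 : G)]
    exact this.symm
  rw [Metric.cauchySeq_iff]
  constructor
  · intro h ε hε
    obtain ⟨N, hN⟩ := h _ (Metric.ball_mem_nhds 1 hε)
    exact ⟨N, fun a ha b hb => by rw [hd]; exact hN a ha b hb⟩
  · intro h V hV
    obtain ⟨ε, hε, hs⟩ := Metric.mem_nhds_iff.1 hV
    obtain ⟨N, hN⟩ := h ε hε
    exact ⟨N, fun a ha b hb => hs (by
      have := hN a ha b hb
      rw [hd] at this
      exact this)⟩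

theorem isCLI_iff [IsTopologicalGroup G] [FirstCountableTopology G] [T0Space G] :
    IsCLI G ↔ ∀ x : ℕ → G, LeftCauchySeq x → ∃ a, Tendsto x atTop (𝓝 a) := by
  constructor
  · rintro ⟨m, ht, hinv, hc⟩ x hx
    rw [leftCauchySeq_iff_cauchySeq m ht hinv] at hx
    subst ht
    exact cauchySeq_tendsto_of_complete hx
  · intro h
    obtain ⟨m, ht, hinv⟩ := exists_leftInvariant_metric (G := G)
    refine ⟨m, ht, hinv, ?_⟩
    have h' := fun x hx => h x ((leftCauchySeq_iff_cauchySeq m ht hinv x).2 hx)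
    subst ht
    exact Metric.complete_of_cauchySeq_tendsto h'

/-- Polish groups are complete for the two-sided uniformity. -/
theorem tendsto_of_leftCauchySeq_of_rightCauchySeq [IsTopologicalGroup G] [PolishSpace G]
    {x : ℕ → G} (hl : LeftCauchySeq x) (hr : RightCauchySeq x) :
    ∃ a, Tendsto x atTop (𝓝 a) := by
  let := TopologicalSpace.upgradeIsCompletelyMetrizable G
  -- Baire category in a complete metric unrelated to the group law: `A k` collects the points near
  -- which the maps `o ↦ x n * o` eventually take values in one small ball. Any `g` in all `A k`
  -- makes `x n * g` Cauchy.
  let A : ℕ → Set G := fun k => {g | ∃ O : Set G, IsOpen O ∧ g ∈ O ∧ ∃ N, ∃ c : G,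
    ∀ n ≥ N, ∀ o ∈ O, dist (x n * o) c < (1 / 2 : ℝ) ^ k}
  have hA : Dense (⋂ k, A k) := by
    refine dense_iInter_of_isOpen_nat (fun k => ?_) (fun k => ?_)
    · rw [isOpen_iff_mem_nhds]
      rintro g ⟨O, hO, hg, h⟩
      exact mem_of_superset (hO.mem_nhds hg) fun g' hg' => ⟨O, hO, hg', h⟩
    · rw [dense_iff_inter_open]
      rintro S hS ⟨s, hs⟩
      have h1 : (fun v => v * s) ⁻¹' S ∈ 𝓝 (1 : G) :=
        (hS.preimage (by fun_prop)).mem_nhds (by simpa using hs)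
      obtain ⟨N, hN⟩ := hl _ h1
      set h := x N * s with hh
      have h2 : ∀ᶠ p : G × G in 𝓝 ((1 : G), (1 : G)),
          p.1 * h * p.2 ∈ Metric.ball h ((1 / 2 : ℝ) ^ k) := by
        have hc : ContinuousAt (fun p : G × G => p.1 * h * p.2) (1, 1) := by fun_prop
        refine hc.eventually_mem ?_
        simpa using Metric.ball_mem_nhds h (by positivity : (0 : ℝ) < (1 / 2) ^ k)
      rw [nhds_prod_eq] at h2
      obtain ⟨P, hP, Q, hQ, hPQ⟩ := Filter.eventually_prod_iff.1 h2
      obtain ⟨M, hM⟩ := hr {v | P v} hP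
      obtain ⟨Q', hQ', hQ'o, h1Q⟩ := mem_nhds_iff.1 hQ
      set K := max M N
      -- The point `(x K)⁻¹ * x N * s` is in `S` by left Cauchyness, and `x n * (x K)⁻¹` is near 1
      -- by right Cauchyness, so `x n` sends its neighbourhood close to `h`.
      refine ⟨(x K)⁻¹ * h, ?_, (fun v => ((x K)⁻¹ * h)⁻¹ * v) ⁻¹' Q',
        hQ'o.preimage (by fun_prop), by simpa using h1Q, K, h, fun n hn o ho => ?_⟩
      · have := hN K (le_max_right _ _) N le_rfl
        simpa [hh, mul_assoc] using this
      · have h3 := hM n ((le_max_left _ _).trans hn) K (le_max_left _ _)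
        have h4 := hPQ h3 (hQ' ho)
        simpa [mul_assoc] using h4
  obtain ⟨g, hg⟩ := hA.nonempty
  rw [mem_iInter] at hg
  have hc : CauchySeq fun n => x n * g := by
    rw [Metric.cauchySeq_iff]
    intro ε hε
    obtain ⟨k, hk⟩ := exists_pow_lt_of_lt_one (half_pos hε) (by norm_num : (1 / 2 : ℝ) < 1)
    obtain ⟨O, -, hgO, N, c, h⟩ := hg k
    refine ⟨N, fun a ha b hb => ?_⟩
    have h1 := h a ha g hgO
    have h2 := h b hb g hgO
    have h3 := dist_triangle_right (x a * g) (x b * g) c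
    linarith
  obtain ⟨a, ha⟩ := cauchySeq_tendsto_of_complete hc
  refine ⟨a * g⁻¹, ?_⟩
  simpa using ha.mul_const g⁻¹

/-- Right translation by `(y N)⁻¹` leaves the quotients `y m * (y n)⁻¹` unchanged and puts the tail
of the sequence in `y N * W * (y N)⁻¹`, which has smaller rank. At rank zero the tail is in `V`
itself. -/
theorem RankLE.eventually_mul_inv_mem [IsTopologicalGroup G] {V U : Set G} {β : Ordinal.{u}}
    (h : RankLE V β U) {y : ℕ → G} (hy : LeftCauchySeq y) (hyU : ∀ᶠ n in atTop, y n ∈ U) :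
    ∃ N, ∀ m ≥ N, ∀ n ≥ N, ∃ v ∈ V, ∃ w ∈ V, y m * (y n)⁻¹ = v * w⁻¹ := by
  induction β using WellFoundedLT.induction generalizing U y with
  | ind β ih =>
    obtain ⟨N₀, hN₀⟩ := eventually_atTop.1 hyU
    rcases rankLE_iff.1 h with h | ⟨W, hW, h1, h⟩
    · exact ⟨N₀, fun m hm n hn => ⟨_, h (hN₀ m hm), _, h (hN₀ n hn), rfl⟩⟩
    · obtain ⟨N₁, hN₁⟩ := hy W (hW.mem_nhds h1)
      set N := max N₀ N₁
      obtain ⟨γ, hγ, hr⟩ := h (y N) (hN₀ N (le_max_left _ _))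
      have hz : LeftCauchySeq fun n => y n * (y N)⁻¹ := by
        intro S hS
        have hS' : (fun v => y N * v * (y N)⁻¹) ⁻¹' S ∈ 𝓝 (1 : G) := by
          have hc : ContinuousAt (fun v => y N * v * (y N)⁻¹) 1 := by fun_prop
          exact hc (by simpa using hS)
        obtain ⟨M, hM⟩ := hy _ hS'
        refine ⟨M, fun m hm n hn => ?_⟩
        simpa [mul_assoc] using hM m hm n hn
      obtain ⟨M, hM⟩ := ih γ hγ hr hz (eventually_atTop.2 ⟨N, fun n hn => by
        rw [mem_conjSet]
        simpa [mul_assoc] using hN₁ N (le_max_right _ _) n ((le_max_right _ _).trans hn)⟩)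
      refine ⟨M, fun m hm n hn => ?_⟩
      simpa [mul_assoc] using hM m hm n hn

theorem LeftCauchySeq.rightCauchySeq [IsTopologicalGroup G] (h : balancedRank G < ⊤)
    {x : ℕ → G} (hx : LeftCauchySeq x) : RightCauchySeq x := by
  intro S hS
  obtain ⟨V, hVS, hV, h1⟩ : ∃ V : Set G, (∀ v ∈ V, ∀ w ∈ V, v * w⁻¹ ∈ S) ∧ IsOpen V ∧ (1 : G) ∈ V := by
    obtain ⟨V, hV, h⟩ := exists_nhds_split_inv hS
    obtain ⟨V', hV', ho, h1⟩ := mem_nhds_iff.1 hV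
    exact ⟨V', fun v hv w hw => by
      simpa [div_eq_mul_inv] using h v (hV' hv) w (hV' hw), ho, h1⟩
  obtain ⟨β, hβ⟩ := exists_rankLE_of_balancedRank_lt_top h hV h1
  obtain ⟨N, hN⟩ := hβ.eventually_mul_inv_mem hx (by simp)
  refine ⟨N, fun m hm n hn => ?_⟩
  obtain ⟨v, hv, w, hw, e⟩ := hN m hm n hn
  rw [e]
  exact hVS v hv w hw

theorem isCLI_of_balancedRank_lt_top [IsTopologicalGroup G] [PolishSpace G]
    (h : balancedRank G < ⊤) : IsCLI G :=
  isCLI_iff.2 fun _ hx => tendsto_of_leftCauchySeq_of_rightCauchySeq hx (hx.rightCauchySeq h)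

end LeftCauchy

/-! ### CLI implies countable rank. -/

section CountableRank

variable {G : Type u} [Group G] [TopologicalSpace G]

/-- The rank `rk(V, U)` is not a countable ordinal. -/
def UncountableRank (V U : Set G) : Prop :=
  ∀ β : Ordinal.{u}, β < ω₁ → ¬ RankLE V β U

theorem exists_countable_ordinal_gt {ι : Type*} [Countable ι] (f : ι → Ordinal.{u}) (hf : ∀ i, f i < ω₁) :
    ∃ β < (ω₁ : Ordinal.{u}), ∀ i, f i < β := by
  have hs : ∀ i, Order.succ (f i) < (ω₁ : Ordinal.{u}) := fun i =>
    (Cardinal.isSuccLimit_omega 1).succ_lt (hf i)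
  have : Small.{u} ι := Countable.toSmall ι
  refine ⟨⨆ i, Order.succ (f i), iSup_lt_omega_one hs, fun i => ?_⟩
  exact (Order.lt_succ _).trans_le (Ordinal.le_iSup (fun i => Order.succ (f i)) i)

/-- Otherwise the ranks over a countable dense subset of `U` have a countable bound. For `d` close
to `g`, a smaller `Q'` satisfies `g Q' g⁻¹ ⊆ d W d⁻¹`, so that bound works for all of `U`. -/
theorem UncountableRank.exists_conjSet [IsTopologicalGroup G] [TopologicalSpace.SeparableSpace G]
    {V U : Set G} (hU : IsOpen U) (h : UncountableRank V U) {W : Set G} (hW : W ∈ 𝓝 (1 : G)) :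
    ∃ d ∈ U, UncountableRank V (conjSet d W) := by
  by_contra! hn
  simp only [UncountableRank, not_forall, not_not, exists_prop] at hn
  obtain ⟨D, hDc, hD⟩ := TopologicalSpace.exists_countable_dense G
  choose! f hf using hn
  have : Countable (D ∩ U : Set G) := (hDc.mono inter_subset_left).to_subtype
  obtain ⟨β, hβ, hβf⟩ := exists_countable_ordinal_gt (fun d : (D ∩ U : Set G) => f d)
    (fun d => (hf d d.2.2).1)
  refine h β hβ (rankLE_iff.2 (Or.inr ?_))
  have h3 : ∀ᶠ p : G × G in 𝓝 ((1 : G), (1 : G)), p.1 * p.2 * p.1⁻¹ ∈ W := by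
    have hc : ContinuousAt (fun p : G × G => p.1 * p.2 * p.1⁻¹) (1, 1) := by fun_prop
    exact hc (by simpa using hW)
  rw [nhds_prod_eq] at h3
  obtain ⟨P, hP, Q, hQ, hPQ⟩ := Filter.eventually_prod_iff.1 h3
  obtain ⟨P', hP', hP'o, h1P⟩ := mem_nhds_iff.1 hP
  obtain ⟨Q', hQ', hQ'o, h1Q⟩ := mem_nhds_iff.1 hQ
  refine ⟨Q', hQ'o, h1Q, fun g hg => ?_⟩
  have hopen : IsOpen ((fun d => d⁻¹ * g) ⁻¹' P' ∩ U) := (hP'o.preimage (by fun_prop)).inter hU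
  obtain ⟨d, ⟨hdP, hdU⟩, hdD⟩ := hD.inter_open_nonempty _ hopen ⟨g, by simpa using h1P, hg⟩
  refine ⟨f d, hβf ⟨d, hdD, hdU⟩, (hf d hdU).2.mono subset_rfl (fun x hx => ?_) le_rfl⟩
  rw [mem_conjSet] at hx ⊢
  have := hPQ (hP' hdP) (hQ' hx)
  simpa [mul_assoc] using this

theorem exists_rankLE_of_isCLI [IsTopologicalGroup G] [PolishSpace G] (h : IsCLI G) {V : Set G}
    (hV : IsOpen V) (h1 : (1 : G) ∈ V) : ∃ β : Ordinal.{u}, β < ω₁ ∧ RankLE V β univ := by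
  by_contra! hn
  have hbad : UncountableRank V univ := hn
  obtain ⟨B, hB, hmul⟩ := IsTopologicalGroup.exists_antitone_basis_nhds_one G
  choose! C hC using fun n => mem_nhds_iff.1 (hB.mem n)
  have hCn : ∀ n, C n ∈ 𝓝 (1 : G) := fun n => (hC n).2.1.mem_nhds (hC n).2.2
  have step : ∀ (x : G) (n : ℕ), UncountableRank V (conjSet x (C n)) →
      ∃ b ∈ C n, UncountableRank V (conjSet (x * b) (C (n + 1))) := by
    intro x n hx
    have hW : conjSet x (C (n + 1)) ∈ 𝓝 (1 : G) :=
      (isOpen_conjSet x (hC _).2.1).mem_nhds (one_mem_conjSet x (hC _).2.2)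
    obtain ⟨d, hd, hr⟩ := hx.exists_conjSet (isOpen_conjSet x (hC n).2.1) hW
    refine ⟨x⁻¹ * d * x, mem_conjSet.1 hd, ?_⟩
    rw [conjSet_conjSet] at hr
    simpa [mul_assoc] using hr
  choose! b hbC hb using step
  obtain ⟨x₀, -, hx₀⟩ := hbad.exists_conjSet isOpen_univ (hCn 0)
  let x : ℕ → G := fun n => Nat.rec x₀ (fun n y => y * b y n) n
  have hxs : ∀ n, x (n + 1) = x n * b (x n) n := fun _ => rfl
  have hx : ∀ n, UncountableRank V (conjSet (x n) (C n)) := by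
    intro n
    induction n with
    | zero => exact hx₀
    | succ n ih => rw [hxs]; exact hb _ _ ih
  have hstep : ∀ n, (x n)⁻¹ * x (n + 1) ∈ B n := fun n => by
    rw [hxs, inv_mul_cancel_left]
    exact (hC n).1 (hbC _ _ (hx n))
  -- Since `B (n + 1) * B (n + 1) ⊆ B n`, the steps from index `n + 1` on telescope into `B n`.
  have hfar : ∀ k n, (x (n + 1))⁻¹ * x (n + 1 + k) ∈ B n := by
    intro k
    induction k with
    | zero => exact fun n => by simpa using mem_of_mem_nhds (hB.mem n)
    | succ k ih =>
      intro n
      have := hmul n (Set.mul_mem_mul (hstep (n + 1)) (ih (n + 1)))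
      simpa [mul_assoc, add_assoc, add_comm, add_left_comm] using this
  have hcauchy : LeftCauchySeq x := by
    intro S hS
    have hS' : {p : G × G | p.1⁻¹ * p.2 ∈ S} ∈ 𝓝 ((1 : G), (1 : G)) := by
      have hc : ContinuousAt (fun p : G × G => p.1⁻¹ * p.2) (1, 1) := by fun_prop
      exact hc (by simpa using hS)
    rw [nhds_prod_eq] at hS'
    obtain ⟨P, hP, hPS⟩ := Filter.mem_prod_same_iff.1 hS'
    obtain ⟨n, hn⟩ := hB.mem_iff.1 hP
    refine ⟨n + 1, fun p hp q hq => ?_⟩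
    obtain ⟨i, rfl⟩ := Nat.exists_eq_add_of_le hp
    obtain ⟨j, rfl⟩ := Nat.exists_eq_add_of_le hq
    have := hPS (Set.mk_mem_prod (hn (hfar i n)) (hn (hfar j n)))
    simpa [mul_assoc] using this
  obtain ⟨a, ha⟩ := isCLI_iff.1 h x hcauchy
  -- Uncountable rank excludes rank zero, that is, containment in `V`.
  have hex : ∀ n, ∃ c ∈ C n, x n * c * (x n)⁻¹ ∉ V := by
    intro n
    by_contra! hc
    refine hx n 0 (omega_pos 1) (rankLE_iff.2 (Or.inl ?_))
    rintro _ ⟨c, hc', rfl⟩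
    exact hc c hc'
  choose c hcC hcV using hex
  have hc1 : Tendsto c atTop (𝓝 1) :=
    hB.tendsto fun n => (hC n).1 (hcC n)
  have hlim : Tendsto (fun n => x n * c n * (x n)⁻¹) atTop (𝓝 (a * 1 * a⁻¹)) :=
    (ha.mul hc1).mul ha.inv
  rw [mul_one, mul_inv_cancel] at hlim
  obtain ⟨n, hn⟩ := (hlim.eventually_mem (hV.mem_nhds h1)).exists
  exact hcV n hn

theorem balancedRank_lt_omega_one_of_isCLI [IsTopologicalGroup G] [PolishSpace G] (h : IsCLI G) :
    balancedRank G < ((ω₁ : Ordinal.{u}) : WithTop Ordinal.{u}) := by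
  obtain ⟨B, hB⟩ := (𝓝 (1 : G)).exists_antitone_basis
  choose! C hC using fun n => mem_nhds_iff.1 (hB.mem n)
  choose f hf using fun n => exists_rankLE_of_isCLI h (hC n).2.1 (hC n).2.2
  obtain ⟨β, hβ, hβf⟩ := exists_countable_ordinal_gt f fun n => (hf n).1
  refine lt_of_le_of_lt (balancedRank_le fun V hV h1 => ?_) (WithTop.coe_lt_coe.2 hβ)
  obtain ⟨n, hn⟩ := hB.mem_iff.1 (hV.mem_nhds h1)
  exact ⟨f n, hβf n, (hf n).2.mono ((hC n).1.trans hn) subset_rfl le_rfl⟩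

theorem isCLI_iff_balancedRank_lt_top [IsTopologicalGroup G] [PolishSpace G] :
    IsCLI G ↔ balancedRank G < ⊤ :=
  ⟨fun h => (balancedRank_lt_omega_one_of_isCLI h).trans_le le_top, isCLI_of_balancedRank_lt_top⟩

theorem balancedRank_lt_top_iff [IsTopologicalGroup G] [PolishSpace G] :
    balancedRank G < ⊤ ↔ balancedRank G < ((ω₁ : Ordinal.{u}) : WithTop Ordinal.{u}) :=
  ⟨fun h => balancedRank_lt_omega_one_of_isCLI (isCLI_of_balancedRank_lt_top h),
    fun h => h.trans_le le_top⟩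

end CountableRank

/-! ### Permutation groups of discrete sets. -/

section PermTopology

variable {X : Type u}

/-- The topology of pointwise convergence of permutations and their inverses, for the discrete
topology on the underlying set. -/
instance permTopology (X : Type u) : TopologicalSpace (Equiv.Perm X) :=
  let _ : TopologicalSpace X := ⊥
  TopologicalSpace.induced (fun g : Equiv.Perm X => ((g : X → X), (g.symm : X → X))) inferInstance

/-- A permutation together with its inverse, as a pair of maps. -/
def permPair (g : Equiv.Perm X) : (X → X) × (X → X) := (g, g.symm)

theorem isInducing_permPair [TopologicalSpace X] [DiscreteTopology X] :
    IsInducing (permPair (X := X)) := by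
  refine ⟨?_⟩
  rw [permTopology, DiscreteTopology.eq_bot (α := X)]
  rfl

theorem continuous_perm_apply [TopologicalSpace X] [DiscreteTopology X] (x : X) :
    Continuous fun g : Equiv.Perm X => g x :=
  (continuous_apply (A := fun _ => X) x).comp
    (continuous_fst.comp isInducing_permPair.continuous)

theorem continuous_perm_symm_apply [TopologicalSpace X] [DiscreteTopology X] (x : X) :
    Continuous fun g : Equiv.Perm X => g.symm x :=
  (continuous_apply (A := fun _ => X) x).comp
    (continuous_snd.comp isInducing_permPair.continuous)

theorem continuous_perm_iff [TopologicalSpace X] [DiscreteTopology X] {Y : Type*}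
    [TopologicalSpace Y] {f : Y → Equiv.Perm X} :
    Continuous f ↔ (∀ x, Continuous fun y => f y x) ∧ ∀ x, Continuous fun y => (f y).symm x :=
  ⟨fun h => ⟨fun x => (continuous_perm_apply x).comp h,
      fun x => (continuous_perm_symm_apply x).comp h⟩,
    fun h => isInducing_permPair.continuous_iff.2
      ((continuous_pi h.1).prodMk (continuous_pi h.2))⟩

theorem continuous_eval_of_discrete [TopologicalSpace X] [DiscreteTopology X] {Y : Type*}
    [TopologicalSpace Y] {f : Y → X → X} {u : Y → X} (hf : ∀ x, Continuous fun y => f y x)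
    (hu : Continuous u) : Continuous fun y => f y (u y) := by
  have h : Continuous fun p : Y × X => f p.1 p.2 := continuous_prod_of_discrete_right.2 hf
  exact h.comp (continuous_id.prodMk hu)

instance : IsTopologicalGroup (Equiv.Perm X) := by
  let _ : TopologicalSpace X := ⊥
  have : DiscreteTopology X := ⟨rfl⟩
  refine { continuous_mul := ?_, continuous_inv := ?_ }
  · rw [continuous_perm_iff]
    constructor <;> intro x
    · exact continuous_eval_of_discrete (f := fun p : Equiv.Perm X × Equiv.Perm X => p.1)
        (fun x => (continuous_perm_apply x).comp continuous_fst) ((continuous_perm_apply x).comp continuous_snd)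
    · exact continuous_eval_of_discrete (f := fun p : Equiv.Perm X × Equiv.Perm X => p.2.symm)
        (fun x => (continuous_perm_symm_apply x).comp continuous_snd) ((continuous_perm_symm_apply x).comp continuous_fst)
  · rw [continuous_perm_iff]
    exact ⟨continuous_perm_symm_apply, continuous_perm_apply⟩

theorem polishSpace_perm [Countable X] : PolishSpace (Equiv.Perm X) := by
  let _ : TopologicalSpace X := ⊥
  have : DiscreteTopology X := ⟨rfl⟩
  have : PolishSpace X := {}
  have hemb : IsEmbedding (permPair (X := X)) :=
    ⟨isInducing_permPair, fun g h e => DFunLike.coe_injective (congrArg Prod.fst e)⟩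
  have hrange : range (permPair (X := X)) =
      ⋂ x, ({p : (X → X) × (X → X) | p.1 (p.2 x) = x} ∩ {p | p.2 (p.1 x) = x}) := by
    ext ⟨p, q⟩
    simp only [mem_range, mem_iInter, mem_inter_iff, mem_ofPred_eq]
    constructor
    · rintro ⟨g, hg⟩ x
      obtain ⟨rfl, rfl⟩ := Prod.mk.inj hg
      exact ⟨g.apply_symm_apply x, g.symm_apply_apply x⟩
    · exact fun h => ⟨⟨p, q, fun x => (h x).2, fun x => (h x).1⟩, rfl⟩
  refine IsClosedEmbedding.polishSpace (f := permPair (X := X)) ⟨hemb, ?_⟩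
  rw [hrange]
  refine isClosed_iInter fun x => IsClosed.inter ?_ ?_
  · exact isClosed_eq (continuous_eval_of_discrete
      (fun x => (continuous_apply x).comp continuous_fst)
      ((continuous_apply x).comp continuous_snd)) continuous_const
  · exact isClosed_eq (continuous_eval_of_discrete
      (fun x => (continuous_apply x).comp continuous_snd)
      ((continuous_apply x).comp continuous_fst)) continuous_const

/-- The pointwise stabilizer of a set in a group of permutations. -/
def fixing (H : Subgroup (Equiv.Perm X)) (F : Set X) : Set H :=
  {g | ∀ x ∈ F, (g : Equiv.Perm X) x = x}

theorem mem_fixing {H : Subgroup (Equiv.Perm X)} {F : Set X} {g : H} :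
    g ∈ fixing H F ↔ ∀ x ∈ F, (g : Equiv.Perm X) x = x := Iff.rfl

theorem one_mem_fixing (H : Subgroup (Equiv.Perm X)) (F : Set X) : (1 : H) ∈ fixing H F :=
  fun _ _ => rfl

theorem isOpen_fixing (H : Subgroup (Equiv.Perm X)) {F : Set X} (hF : F.Finite) :
    IsOpen (fixing H F) := by
  let _ : TopologicalSpace X := ⊥
  have : DiscreteTopology X := ⟨rfl⟩
  have : fixing H F = ⋂ x ∈ F, (fun g : H => (g : Equiv.Perm X) x) ⁻¹' {x} := by
    ext g
    simp [mem_fixing]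
  rw [this]
  exact hF.isOpen_biInter fun x _ => (isOpen_discrete _).preimage
    ((continuous_perm_apply x).comp continuous_subtype_val)

theorem conjSet_fixing (H : Subgroup (Equiv.Perm X)) (F : Set X) (g : H) :
    conjSet g (fixing H F) = fixing H ((g : Equiv.Perm X) '' F) := by
  ext h
  simp only [mem_conjSet, mem_fixing, forall_mem_image, Subgroup.coe_mul, Subgroup.coe_inv,
    Equiv.Perm.mul_apply, Equiv.Perm.inv_eq_iff_eq]

theorem exists_fixing_subset (H : Subgroup (Equiv.Perm X)) {V : Set H} (hV : IsOpen V)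
    (h1 : (1 : H) ∈ V) : ∃ F : Finset X, fixing H F ⊆ V := by
  classical
  let _ : TopologicalSpace X := ⊥
  have : DiscreteTopology X := ⟨rfl⟩
  have hφ : IsInducing fun g : H => permPair (g : Equiv.Perm X) :=
    isInducing_permPair.comp IsInducing.subtypeVal
  have hmem := hV.mem_nhds h1
  rw [hφ.nhds_eq_comap, mem_comap] at hmem
  obtain ⟨S, hS, hSV⟩ := hmem
  rw [nhds_prod_eq] at hS
  obtain ⟨A, hA, B, hB, hAB⟩ := Filter.mem_prod_iff.1 hS
  have key : ∀ A ∈ 𝓝 (id : X → X), ∃ F : Finset X, ∀ f : X → X, (∀ x ∈ F, f x = x) → f ∈ A := by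
    intro A hA
    rw [nhds_pi, Filter.mem_pi] at hA
    obtain ⟨I, hI, t, ht, hs⟩ := hA
    refine ⟨hI.toFinset, fun f hf => hs fun i hi => ?_⟩
    rw [hf i (hI.mem_toFinset.2 hi)]
    exact mem_of_mem_nhds (ht i)
  obtain ⟨F₁, h₁⟩ := key A hA
  obtain ⟨F₂, h₂⟩ := key B hB
  refine ⟨F₁ ∪ F₂, fun g hg => hSV (hAB ⟨h₁ _ fun x hx => ?_, h₂ _ fun x hx => ?_⟩)⟩
  · exact hg x (by simp [hx])
  · exact (Equiv.symm_apply_eq _).2 (hg x (by simp [hx])).symm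

end PermTopology

/-! ### The tower group and its moves. -/

section Tower

variable {κ : Type u} [LinearOrder κ]

/-- `g` preserves, for any two points, the last coordinate at which they differ, together with the
difference there. -/
def PreservesLead (g : (κ →₀ ℤ) → (κ →₀ ℤ)) : Prop :=
  ∀ x y : κ →₀ ℤ, ∀ b, (∀ c > b, x c = y c) → ∀ c ≥ b, g x c - g y c = x c - y c

variable (κ) in
/-- The group of permutations of `κ →₀ ℤ` that fix `0` and preserve the leading term of the
difference of any two points. -/
def towerGroup : Subgroup (Equiv.Perm (κ →₀ ℤ)) where
  carrier := {g | g 0 = 0 ∧ PreservesLead g ∧ PreservesLead g.symm}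
  one_mem' := ⟨rfl, fun _ _ _ _ _ _ => rfl, fun _ _ _ _ _ _ => rfl⟩
  inv_mem' := by
    rintro g ⟨h0, h1, h2⟩
    exact ⟨by rw [Equiv.Perm.inv_eq_iff_eq, h0], h2, h1⟩
  mul_mem' := by
    have comp : ∀ {g h : (κ →₀ ℤ) → (κ →₀ ℤ)}, PreservesLead g → PreservesLead h →
        PreservesLead (g ∘ h) := by
      intro g h hg hh x y b hxy c hc
      have h1 := hh x y b hxy
      refine (hg (h x) (h y) b (fun c hc => ?_) c hc).trans (h1 c hc)
      have := h1 c hc.le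
      exact sub_eq_zero.1 (this.trans (sub_eq_zero.2 (hxy c hc)))
    rintro g h ⟨g0, g1, g2⟩ ⟨h0, h1, h2⟩
    exact ⟨by simp [h0, g0], comp (g := g) (h := h) g1 h1, comp (g := h.symm) (h := g.symm) h2 g2⟩

theorem isClosed_towerGroup : IsClosed (towerGroup κ : Set (Equiv.Perm (κ →₀ ℤ))) := by
  let _ : TopologicalSpace (κ →₀ ℤ) := ⊥
  have : DiscreteTopology (κ →₀ ℤ) := ⟨rfl⟩
  have hlead : ∀ φ : Equiv.Perm (κ →₀ ℤ) → (κ →₀ ℤ) → (κ →₀ ℤ),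
      (∀ x, Continuous fun g => φ g x) → IsClosed {g | PreservesLead (φ g)} := by
    intro φ hφ
    simp only [PreservesLead, ofPred_forall]
    refine isClosed_iInter fun x => isClosed_iInter fun y => isClosed_iInter fun b =>
      isClosed_iInter fun _ => isClosed_iInter fun c => isClosed_iInter fun _ => ?_
    exact isClosed_eq
      (((continuous_of_discreteTopology (f := fun z : κ →₀ ℤ => z c)).comp (hφ x)).sub
        ((continuous_of_discreteTopology (f := fun z : κ →₀ ℤ => z c)).comp (hφ y)))
      continuous_const
  exact (isClosed_eq (continuous_perm_apply 0) continuous_const).inter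
    ((hlead (fun g => g) continuous_perm_apply).inter
      (hlead (fun g => g.symm) continuous_perm_symm_apply))

open Classical in
/-- Add `n` to the coordinate `d` of the points that agree with `x` on `[b, ∞)`. -/
noncomputable def blockShift (x : κ →₀ ℤ) (b d : κ) (n : ℤ) (z : κ →₀ ℤ) : κ →₀ ℤ :=
  if ∀ c ≥ b, z c = x c then z + Finsupp.single d n else z

theorem blockShift_apply_of_lt {x : κ →₀ ℤ} {b d : κ} (n : ℤ) (z : κ →₀ ℤ) {c : κ} (hc : d < c) :
    blockShift x b d n z c = z c := by
  unfold blockShift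
  split_ifs
  · simp [Finsupp.single_eq_of_ne hc.ne']
  · rfl

theorem blockShift_neg {x : κ →₀ ℤ} {b d : κ} (hd : d < b) (n : ℤ) (z : κ →₀ ℤ) :
    blockShift x b d (-n) (blockShift x b d n z) = z := by
  have h : (∀ c ≥ b, blockShift x b d n z c = x c) ↔ ∀ c ≥ b, z c = x c :=
    forall₂_congr fun c hc => by rw [blockShift_apply_of_lt n z (hd.trans_le hc)]
  rw [blockShift]
  by_cases hz : ∀ c ≥ b, z c = x c
  · rw [if_pos (h.2 hz), blockShift, if_pos hz]
    simp [add_assoc]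
  · rw [if_neg (mt h.1 hz), blockShift, if_neg hz]

/-- Above `d` the shift is invisible. Two points whose comparison reaches down only to coordinates
at most `d` must be shown to agree above them, hence on `[b, ∞)`, so both are shifted or neither is.
-/
theorem preservesLead_blockShift {x : κ →₀ ℤ} {b d : κ} (hd : d < b) (n : ℤ) :
    PreservesLead (blockShift x b d n) := by
  intro y z e hyz c hc
  rcases lt_or_ge d c with hdc | hcd
  · rw [blockShift_apply_of_lt n y hdc, blockShift_apply_of_lt n z hdc]
  · have h : (∀ c ≥ b, y c = x c) ↔ ∀ c ≥ b, z c = x c :=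
      forall₂_congr fun c' hc' => by rw [hyz c' ((hc.le.trans hcd).trans_lt (hd.trans_le hc'))]
    unfold blockShift
    by_cases hz : ∀ c ≥ b, z c = x c
    · rw [if_pos hz, if_pos (h.2 hz)]
      simp
    · rw [if_neg hz, if_neg (mt h.1 hz)]

/-- The engine of the lower bound: a shift at `d` on the block of `x` misses `F`, and a suitable
amount pushes all of `F'` out of the smaller block of `x` at `d`. -/
theorem exists_mem_towerGroup_moving {x : κ →₀ ℤ} {b d : κ} (hd : d < b) {F : Set (κ →₀ ℤ)}
    (h0 : 0 ∈ F) (hF : ∀ y ∈ F, ¬ ∀ c ≥ b, y c = x c) (F' : Finset (κ →₀ ℤ)) :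
    ∃ g ∈ fixing (towerGroup κ) F, (g : Equiv.Perm (κ →₀ ℤ)) x ≠ x ∧
      ∀ y ∈ F', ¬ ∀ c ≥ d, (g : Equiv.Perm (κ →₀ ℤ)) y c = x c := by
  classical
  -- Avoiding 0 moves `x`; avoiding `x d - y d` keeps `y` from landing on the value of `x` at `d`.
  obtain ⟨n, hn⟩ := Infinite.exists_notMem_finset (insert 0 (F'.image fun y => x d - y d))
  simp only [Finset.mem_insert, Finset.mem_image, not_or, not_exists, not_and] at hn
  have hfix : ∀ y ∈ F, ∀ n, blockShift x b d n y = y := fun y hy n => if_neg (hF y hy)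
  let g : Equiv.Perm (κ →₀ ℤ) :=
    ⟨blockShift x b d n, blockShift x b d (-n), blockShift_neg hd n, fun z => by
      simpa using blockShift_neg hd (-n) z⟩
  refine ⟨⟨g, hfix 0 h0 n, preservesLead_blockShift hd n, preservesLead_blockShift hd (-n)⟩,
    fun y hy => hfix y hy n, ?_, fun y hy h => ?_⟩
  · show blockShift x b d n x ≠ x
    rw [blockShift, if_pos fun _ _ => rfl]
    simpa using hn.1
  · have h' : ∀ c ≥ d, blockShift x b d n y c = x c := h
    by_cases hy' : ∀ c ≥ b, y c = x c
    · have := h' d le_rfl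
      rw [blockShift, if_pos hy', Finsupp.add_apply, Finsupp.single_eq_same] at this
      exact hn.2 y hy (by omega)
    · rw [blockShift, if_neg hy'] at h'
      exact hy' fun c hc => h' c (hd.le.trans hc)

/-- The engine of the upper bound: `b'` is the largest coordinate at which `g` changes a point of
`F`. It lies below `b`, as comparison with a fixed point of `E` freezes all coordinates from `b` up.
-/
theorem exists_lt_agree_of_mem_fixing {b : κ} {F : Finset (κ →₀ ℤ)} {E : Set (κ →₀ ℤ)}
    (hFE : ∀ x ∈ F, ∃ y ∈ E, ∀ c > b, x c = y c) {g : towerGroup κ}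
    (hg : g ∈ fixing (towerGroup κ) E) (hgF : g ∉ fixing (towerGroup κ) F) :
    ∃ b' < b, ∀ x ∈ F, ∀ c > b', x c = (g : Equiv.Perm (κ →₀ ℤ)) x c := by
  classical
  set S := F.biUnion fun x => ((g : Equiv.Perm (κ →₀ ℤ)) x - x).support with hS
  have hS_mem : ∀ c, c ∈ S ↔ ∃ x ∈ F, (g : Equiv.Perm (κ →₀ ℤ)) x c ≠ x c := fun c => by
    simp [hS, sub_eq_zero]
  have hne : S.Nonempty := by
    by_contra hne
    rw [Finset.not_nonempty_iff_eq_empty] at hne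
    refine hgF fun x hx => Finsupp.ext fun c => ?_
    by_contra hc
    have := (hS_mem c).2 ⟨x, hx, hc⟩
    simp [hne] at this
  refine ⟨S.max' hne, ?_, fun x hx c hc => ?_⟩
  · obtain ⟨x, hx, hc⟩ := (hS_mem _).1 (S.max'_mem hne)
    by_contra hlt
    obtain ⟨y, hy, hxy⟩ := hFE x hx
    have := g.2.2.1 x y b hxy _ (not_lt.1 hlt)
    rw [hg y hy] at this
    exact hc (sub_left_injective this)
  · by_contra hne'
    exact absurd (S.le_max' c ((hS_mem c).2 ⟨x, hx, Ne.symm hne'⟩)) (not_le.2 hc)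

end Tower

/-! ### The rank of the tower group is `α`. -/

section TowerRank

variable {α : Ordinal.{u}}

/-- The ordinal below `α` that corresponds to an element of `α.ToType`. -/
noncomputable def position (b : α.ToType) : Ordinal.{u} := (ToType.mk.symm b : Iio α)

theorem position_lt (b : α.ToType) : position b < α := (ToType.mk.symm b).2

theorem position_lt_position {b c : α.ToType} : position b < position c ↔ b < c :=
  (ToType.mk (o := α)).symm.lt_iff_lt

theorem exists_position_eq {o : Ordinal.{u}} (h : o < α) : ∃ b : α.ToType, position b = o :=
  ⟨ToType.mk ⟨o, h⟩, by simp [position]⟩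

theorem rankLE_fixing (b : α.ToType) {F : Finset (α.ToType →₀ ℤ)} {E : Set (α.ToType →₀ ℤ)}
    (hFE : ∀ x ∈ F, ∃ y ∈ E, ∀ c > b, x c = y c) :
    RankLE (fixing (towerGroup α.ToType) F) (position b) (fixing (towerGroup α.ToType) E) := by
  induction b using WellFoundedLT.induction generalizing E with
  | ind b ih =>
    rw [rankLE_iff]
    by_cases hsub : fixing (towerGroup α.ToType) E ⊆ fixing (towerGroup α.ToType) F
    · exact Or.inl hsub
    -- The same `W`, the stabilizer of `F`, serves at every stage; conjugation replaces `F` by its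
    -- image under `g`.
    refine Or.inr ⟨_, isOpen_fixing _ F.finite_toSet, one_mem_fixing _ _, fun g hg => ?_⟩
    rw [conjSet_fixing]
    by_cases hgF : g ∈ fixing (towerGroup α.ToType) F
    · obtain ⟨g₀, hg₀, hg₀F⟩ := not_subset.1 hsub
      obtain ⟨b', hb', -⟩ := exists_lt_agree_of_mem_fixing hFE hg₀ hg₀F
      refine ⟨position b', position_lt_position.2 hb', rankLE_iff.2 (Or.inl ?_)⟩
      intro h hh x hx
      simpa [hgF x hx] using hh _ (mem_image_of_mem _ hx)
    · obtain ⟨b', hb', hag⟩ := exists_lt_agree_of_mem_fixing hFE hg hgF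
      exact ⟨position b', position_lt_position.2 hb',
        ih b' hb' fun x hx => ⟨_, mem_image_of_mem _ hx, hag x hx⟩⟩

theorem position_le_of_rankLE {x : α.ToType →₀ ℤ} {o : Ordinal.{u}} {U : Set (towerGroup α.ToType)}
    (h : RankLE (fixing (towerGroup α.ToType) {x}) o U) {b : α.ToType} {F : Set (α.ToType →₀ ℤ)}
    (hFU : fixing (towerGroup α.ToType) F ⊆ U) (h0 : 0 ∈ F)
    (hF : ∀ y ∈ F, ¬ ∀ c ≥ b, y c = x c) : position b ≤ o := by
  classical
  induction o using WellFoundedLT.induction generalizing U b F with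
  | ind o ih =>
    by_contra! hlt
    -- With `o` the position of `d < b`, some `g` in `U` moves `F'` off the block of `x` at `d`. By
    -- induction the conjugate of `W` then has rank at least `o`, whereas the definition demands
    -- less.
    obtain ⟨d, rfl⟩ := exists_position_eq (hlt.trans (position_lt b))
    rw [position_lt_position] at hlt
    rcases rankLE_iff.1 h with h | ⟨W, hW, h1, h⟩
    · obtain ⟨g, hg, hgx, -⟩ := exists_mem_towerGroup_moving hlt h0 hF ∅
      exact hgx (h (hFU hg) x rfl)
    · obtain ⟨F', hF'⟩ := exists_fixing_subset _ hW h1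
      obtain ⟨g, hg, -, hgF'⟩ := exists_mem_towerGroup_moving hlt h0 hF (insert 0 F')
      obtain ⟨γ, hγ, hr⟩ := h g (hFU hg)
      refine absurd (ih γ hγ hr (b := d)
        (F := (g : Equiv.Perm (α.ToType →₀ ℤ)) '' ((insert 0 F' : Finset _) : Set _)) ?_ ?_ ?_)
        (not_le.2 hγ)
      · rw [← conjSet_fixing]
        exact conjSet_mono _ (Subset.trans (fun k hk y hy => hk y (Finset.mem_insert_of_mem hy)) hF')
      · exact ⟨0, by simp, g.2.1⟩
      · rintro _ ⟨y, hy, rfl⟩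
        exact hgF' y hy

theorem balancedRank_towerGroup (hα : 0 < α) : balancedRank (towerGroup α.ToType) = α := by
  classical
  have huniv : fixing (towerGroup α.ToType) {0} = univ :=
    eq_univ_of_forall fun g => by rintro _ rfl; exact g.2.1
  refine le_antisymm (balancedRank_le fun V hV h1 => ?_) (le_of_forall_lt fun c hc => ?_)
  · obtain ⟨F, hF⟩ := exists_fixing_subset _ hV h1
    have hS_mem : ∀ x ∈ F, ∀ c, x c ≠ 0 → c ∈ F.biUnion Finsupp.support := fun x hx c hc =>
      Finset.mem_biUnion.2 ⟨x, hx, Finsupp.mem_support_iff.2 hc⟩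
    rcases (F.biUnion Finsupp.support).eq_empty_or_nonempty with hS | hS
    -- Empty support means `F ⊆ {0}`, whose stabilizer is everything: rank zero, and `0 < α` is
    -- needed.
    · refine ⟨0, hα, rankLE_iff.2 (Or.inl (fun g _ => hF fun x hx => ?_))⟩
      have hx0 : x = 0 := Finsupp.ext fun c => by
        by_contra hc
        have := hS_mem x hx c hc
        simp [hS] at this
      rw [hx0]
      exact g.2.1
    · refine ⟨position ((F.biUnion Finsupp.support).max' hS), position_lt _, ?_⟩
      rw [← huniv]
      refine (rankLE_fixing (E := {0}) _ fun x hx => ⟨0, rfl, fun c hc => ?_⟩).mono hF subset_rfl le_rfl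
      by_contra hne
      exact absurd (Finset.le_max' _ c (hS_mem x hx c hne)) (not_le.2 hc)
  · obtain ⟨o, rfl⟩ := WithTop.ne_top_iff_exists.1 (hc.trans_le le_top).ne
    obtain ⟨b, rfl⟩ := exists_position_eq (WithTop.coe_lt_coe.1 hc)
    refine lt_balancedRank (V := fixing _ {Finsupp.single b 1})
      (isOpen_fixing _ (finite_singleton _)) (one_mem_fixing _ _) fun γ hγ => ?_
    refine position_le_of_rankLE hγ (F := {0}) (subset_univ _) rfl ?_
    rintro _ rfl h
    simpa using h b le_rfl

theorem countable_toType_of_lt_omega_one (h : α < ω₁) : Countable α.ToType := by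
  rw [← Cardinal.mk_le_aleph0_iff, Cardinal.mk_toType, ← Order.lt_succ_iff, Cardinal.succ_aleph0]
  rwa [← Cardinal.ord_aleph, Cardinal.lt_ord] at h

theorem polishSpace_towerGroup (h : α < ω₁) : PolishSpace (towerGroup α.ToType) := by
  have := countable_toType_of_lt_omega_one h
  have := polishSpace_perm (X := α.ToType →₀ ℤ)
  exact isClosed_towerGroup.polishSpace

end TowerRank

end BalancedGroup

theorem theorem1p2 :
    (∀ (G : Type u) [Group G] [TopologicalSpace G] [IsTopologicalGroup G] [PolishSpace G],
      (BalancedGroup.IsCLI G ↔ BalancedGroup.balancedRank G < ⊤) ∧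
      (BalancedGroup.balancedRank G < ⊤ ↔
        BalancedGroup.balancedRank G < ((ω₁ : Ordinal.{u}) : WithTop Ordinal.{u}))) ∧
    (∀ α : Ordinal.{u}, 0 < α → α < ω₁ →
      ∃ (G : Type u) (_ : Group G) (_ : TopologicalSpace G),
        IsTopologicalGroup G ∧ PolishSpace G ∧
          BalancedGroup.balancedRank G = (α : WithTop Ordinal.{u})) :=
  ⟨fun _ _ _ _ _ =>
      ⟨BalancedGroup.isCLI_iff_balancedRank_lt_top, BalancedGroup.balancedRank_lt_top_iff⟩,
    fun α hα hα₁ => ⟨BalancedGroup.towerGroup α.ToType, inferInstance, inferInstance,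
      inferInstance, BalancedGroup.polishSpace_towerGroup hα₁,
      BalancedGroup.balancedRank_towerGroup hα⟩⟩
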